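/- **Corollary (Local cone theorem).** Let $(M,g)$ be a complete connected Riemannian manifold (without boundary). A smooth map $f:M\to\mathbb{R}^n$ is *harmonic* if it is a critical point of the Dirichlet energy $E[f]=\frac12\int_M\|df\|^2\,d\mathrm{Vol}_g$, where $\|\cdot\|$ is the Hilbert–Schmidt norm; that is, for every smooth compactly supported $\varphi:M\to\mathbb{R}^n$, $$\frac{d}{dt}\Big|_{t=0}\ \frac12\int_{\operatorname{supp}\varphi}\|d(f+t\varphi)\|^2\,d\mathrm{Vol}_g=0 .$$ It is *proper* if preimages of compact sets are compact. Let $C\subseteq\mathbb{R}^n$ be a closed set and $H\subset\mathbb{R}^n$ an affine hyperplane, and let $B$ be a connected component of $\mathbb{R}^n\setminus(C\cup H)$ whose closure is compact. If $f:M\to\mathbb{R}^n$ is a non-constant proper harmonic map with $f(p)\in B$ for some $p\in M$, then there is a point $q\in M$ with $f(q)\in C$; moreover, $q$ can be chosen with $f(q)\in C\cap\partial B$, i.e. a harmonic map entering $B$ has to leave $B$ through $C$. -/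

import Mathlib

open Bundle Manifold MeasureTheory
open scoped ContDiff

-- Instance search on `ℝⁿ` finds the charted space structure with the identity as only chart
-- directly, not through a type synonym.
attribute [local instance 2000] chartedSpaceSelf

noncomputable section

namespace LocalCone

instance finiteDimensional_tangentSpace {m : ℕ} {M : Type*} [TopologicalSpace M]
    [ChartedSpace (EuclideanSpace ℝ (Fin m)) M] (x : M) :
    FiniteDimensional ℝ (TangentSpace (𝓡 m) x) :=
  inferInstanceAs (FiniteDimensional ℝ (EuclideanSpace ℝ (Fin m)))

/-- The `i`-th coordinate vector field `∂ᵢ` of the chart of `M` around `x`, at the point whose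
coordinates in that chart are `y`. -/
def coordVector {m : ℕ} {M : Type*} [TopologicalSpace M]
    [ChartedSpace (EuclideanSpace ℝ (Fin m)) M] (x : M) (y : EuclideanSpace ℝ (Fin m))
    (i : Fin m) :
    TangentSpace (𝓡 m) ((chartAt (EuclideanSpace ℝ (Fin m)) x).symm y) :=
  mfderiv (𝓡 m) (𝓡 m) (chartAt (EuclideanSpace ℝ (Fin m)) x).symm y (EuclideanSpace.single i 1)

/-- The density `√det(g(∂ᵢ, ∂ⱼ))` of the Riemannian volume in the chart around `x`, as a function
of the coordinates `y`. -/
def volumeDensity {m : ℕ} {M : Type*} [TopologicalSpace M]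
    [ChartedSpace (EuclideanSpace ℝ (Fin m)) M]
    [RiemannianBundle (fun x : M ↦ TangentSpace (𝓡 m) x)]
    (x : M) (y : EuclideanSpace ℝ (Fin m)) : ℝ :=
  √(Matrix.of fun i j : Fin m ↦ inner ℝ (coordVector x y i) (coordVector x y j)).det

/-- The Riemannian volume of the domain of the chart around `x`, as a measure on `M` carried by
that domain: the image under the inverse chart of `√det(g(∂ᵢ, ∂ⱼ)) dy`. -/
def chartVolume (m : ℕ) {M : Type*} [TopologicalSpace M]
    [ChartedSpace (EuclideanSpace ℝ (Fin m)) M]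
    [RiemannianBundle (fun x : M ↦ TangentSpace (𝓡 m) x)] [MeasurableSpace M]
    (x : M) : Measure M :=
  (((volume : Measure (EuclideanSpace ℝ (Fin m))).restrict
      (chartAt (EuclideanSpace ℝ (Fin m)) x).target).withDensity
    fun y ↦ ENNReal.ofReal (volumeDensity x y)).map (chartAt (EuclideanSpace ℝ (Fin m)) x).symm

/-- The Riemannian volume measure `dVol_g` on `M`. The measures `chartVolume m x` agree on the
overlaps of the chart domains, and their supremum in the lattice of measures is the measure that
restricts to each of them. -/
def riemannianVolume (m : ℕ) (M : Type*) [TopologicalSpace M]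
    [ChartedSpace (EuclideanSpace ℝ (Fin m)) M]
    [RiemannianBundle (fun x : M ↦ TangentSpace (𝓡 m) x)] [MeasurableSpace M] : Measure M :=
  ⨆ x : M, chartVolume m x

/-- The differential `df` at `x` of a map `f : M → ℝⁿ`, with the tangent spaces of `ℝⁿ` identified
with `ℝⁿ`. -/
def differential (m : ℕ) {n : ℕ} {M : Type*} [TopologicalSpace M]
    [ChartedSpace (EuclideanSpace ℝ (Fin m)) M] (f : M → EuclideanSpace ℝ (Fin n)) (x : M) :
    TangentSpace (𝓡 m) x →L[ℝ] EuclideanSpace ℝ (Fin n) :=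
  mfderiv (𝓡 m) (𝓡 n) f x

/-- The squared Hilbert-Schmidt norm `‖df‖² = ∑ᵢ |df(eᵢ)|²` of the differential of `f` at `x`,
where `(eᵢ)` is an orthonormal basis of the tangent space at `x`. -/
def normSqDifferential (m : ℕ) {n : ℕ} {M : Type*} [TopologicalSpace M]
    [ChartedSpace (EuclideanSpace ℝ (Fin m)) M]
    [RiemannianBundle (fun x : M ↦ TangentSpace (𝓡 m) x)]
    (f : M → EuclideanSpace ℝ (Fin n)) (x : M) : ℝ :=
  ∑ i, ‖differential m f x (stdOrthonormalBasis ℝ (TangentSpace (𝓡 m) x) i)‖ ^ 2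

/-- The Dirichlet energy `½ ∫_K ‖df‖² dVol_g` of `f` over `K`. -/
def dirichletEnergy (m : ℕ) {n : ℕ} {M : Type*} [TopologicalSpace M]
    [ChartedSpace (EuclideanSpace ℝ (Fin m)) M]
    [RiemannianBundle (fun x : M ↦ TangentSpace (𝓡 m) x)] [MeasurableSpace M]
    (K : Set M) (f : M → EuclideanSpace ℝ (Fin n)) : ℝ :=
  (1 / 2) * ∫ x in K, normSqDifferential m f x ∂(riemannianVolume m M)

/-- A smooth map `f : M → ℝⁿ` is harmonic if it is a critical point of the Dirichlet energy with
respect to smooth compactly supported variations `f + t φ`. The energy is taken over the (compact)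
support of the variation, off which `f + t φ` does not depend on `t`. -/
def IsHarmonicMap (m : ℕ) {n : ℕ} {M : Type*} [TopologicalSpace M]
    [ChartedSpace (EuclideanSpace ℝ (Fin m)) M]
    [RiemannianBundle (fun x : M ↦ TangentSpace (𝓡 m) x)] [MeasurableSpace M]
    (f : M → EuclideanSpace ℝ (Fin n)) : Prop :=
  ContMDiff (𝓡 m) (𝓡 n) ∞ f ∧
    ∀ φ : M → EuclideanSpace ℝ (Fin n), ContMDiff (𝓡 m) (𝓡 n) ∞ φ → HasCompactSupport φ →
      HasDerivAt (fun t : ℝ ↦ dirichletEnergy m (tsupport φ) (fun x ↦ f x + t • φ x)) 0 0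

/-- `H` is an affine hyperplane of `ℝⁿ`. -/
def IsHyperplane {n : ℕ} (H : Set (EuclideanSpace ℝ (Fin n))) : Prop :=
  ∃ ν : EuclideanSpace ℝ (Fin n), ν ≠ 0 ∧ ∃ c : ℝ, H = {y | inner ℝ ν y = c}

/-- `C` is a local cone in `ℝⁿ` with local cone region `B`: `C` is closed, and there is a
hyperplane `H` such that `B` is a precompact connected component of `ℝⁿ ∖ (C ∪ H)`. -/
def IsLocalConeWithRegion {n : ℕ} (C B : Set (EuclideanSpace ℝ (Fin n))) : Prop :=
  IsClosed C ∧ ∃ H : Set (EuclideanSpace ℝ (Fin n)), IsHyperplane H ∧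
    (∃ b ∈ (C ∪ H)ᶜ, B = connectedComponentIn (C ∪ H)ᶜ b) ∧ IsCompact (closure B)

end LocalCone

end

/-! Argue by contradiction: suppose no boundary point of `B` hit by `f` lies in `C`. The region lies
strictly on one side of the hyperplane, say at heights `⟨ν, ·⟩ > c`, with `H` at height `c`. Points
of `f(M)` in the closure of `B` above height `c` then lie in `B`. For `c'` between `c` and the
height of `f p`, let `χ = expNegInvGlue` and vary `f` by `χ(⟨ν, f⟩ - c') ν`, extended by zero off
the preimage of `B`. This is smooth, and compactly supported because `f` is proper. Its pairing with
`df` is `χ' |d⟨ν, f⟩|² ≥ 0`, while criticality makes the integral vanish; so the height of `f` is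
locally constant wherever `f` is in `B` above `c'`.

The points mapped to the closure of `B` at the height of `f p` therefore form a clopen set, hence
all of `M`. So `M` is compact, and varying `f` along itself gives `df = 0`: `f` is constant, a
contradiction.

The analytic input is `IsHarmonicMap.innerDifferential_eq_zero`. It rests on continuity of `⟨df,
dφ⟩` and on the Riemannian volume being locally finite and positive on nonempty open sets. -/

namespace LocalCone

noncomputable section

/-! ### The metric and the coordinate frame in a chart. -/

section Metric

variable {m : ℕ} {M : Type*} [TopologicalSpace M] [ChartedSpace (EuclideanSpace ℝ (Fin m)) M]
  [RiemannianBundle (fun x : M ↦ TangentSpace (𝓡 m) x)]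

/-- The matrix `g(∂ᵢ, ∂ⱼ)` in the chart around `x`, as a function of the coordinates. -/
def metricMatrix (x : M) (y : EuclideanSpace ℝ (Fin m)) : Matrix (Fin m) (Fin m) ℝ :=
  Matrix.gram ℝ (coordVector x y)

end Metric

section Frame

variable {m : ℕ} {M : Type*} [TopologicalSpace M] [ChartedSpace (EuclideanSpace ℝ (Fin m)) M]
  [IsManifold (𝓡 m) ∞ M]

theorem mdifferentiableAt_chart_symm (x : M) {y : EuclideanSpace ℝ (Fin m)}
    (hy : y ∈ (chartAt (EuclideanSpace ℝ (Fin m)) x).target) :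
    MDifferentiableAt (𝓡 m) (𝓡 m) (chartAt (EuclideanSpace ℝ (Fin m)) x).symm y :=
  (mdifferentiable_chart x).mdifferentiableAt_symm hy

theorem continuousOn_coordVector (x : M) (i : Fin m) :
    ContinuousOn (fun y ↦ (⟨(chartAt (EuclideanSpace ℝ (Fin m)) x).symm y, coordVector x y i⟩ :
      TangentBundle (𝓡 m) M)) (chartAt (EuclideanSpace ℝ (Fin m)) x).target := by
  set e := chartAt (EuclideanSpace ℝ (Fin m)) x
  have h := (contMDiffOn_chart_symm (I := 𝓡 m) (n := ∞) (x := x)).continuousOn_tangentMapWithin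
    (by simp) e.open_target.uniqueMDiffOn
  have hs : Continuous fun y : EuclideanSpace ℝ (Fin m) ↦
      (⟨y, EuclideanSpace.single i 1⟩ : TangentBundle (𝓡 m) (EuclideanSpace ℝ (Fin m))) :=
    (tangentBundleModelSpaceHomeomorph (𝓡 m)).symm.continuous.comp
      (Continuous.prodMk_left (EuclideanSpace.single i (1 : ℝ)))
  refine (h.comp hs.continuousOn fun y hy ↦ hy).congr fun y hy ↦ ?_
  simp only [Function.comp_apply, tangentMapWithin]
  rw [mfderivWithin_of_isOpen e.open_target hy]
  rfl

theorem linearIndependent_coordVector (x : M) {y : EuclideanSpace ℝ (Fin m)}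
    (hy : y ∈ (chartAt (EuclideanSpace ℝ (Fin m)) x).target) :
    LinearIndependent ℝ (coordVector x y) := by
  refine Fintype.linearIndependent_iff.2 fun c hc ↦ ?_
  let L : EuclideanSpace ℝ (Fin m) →L[ℝ] EuclideanSpace ℝ (Fin m) :=
    mfderiv (𝓡 m) (𝓡 m) (chartAt (EuclideanSpace ℝ (Fin m)) x).symm y
  have hL : Function.Injective L :=
    ((mdifferentiable_chart (I := 𝓡 m) x).symm.mfderiv hy).injective
  have h : ∑ i, c i • (EuclideanSpace.basisFun (Fin m) ℝ).toBasis i = 0 := by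
    refine hL ?_
    rw [map_zero, map_sum]
    refine Eq.trans (Finset.sum_congr rfl fun i _ ↦ ?_) hc
    rw [map_smul, OrthonormalBasis.coe_toBasis, EuclideanSpace.basisFun_apply]
    rfl
  exact Fintype.linearIndependent_iff.1 (Module.Basis.linearIndependent _) c h

variable [RiemannianBundle (fun x : M ↦ TangentSpace (𝓡 m) x)]

theorem posDef_metricMatrix (x : M) {y : EuclideanSpace ℝ (Fin m)}
    (hy : y ∈ (chartAt (EuclideanSpace ℝ (Fin m)) x).target) : (metricMatrix x y).PosDef := by
  unfold metricMatrix
  apply Matrix.posDef_gram_of_linearIndependent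
  exact linearIndependent_coordVector x hy

theorem det_metricMatrix_pos (x : M) {y : EuclideanSpace ℝ (Fin m)}
    (hy : y ∈ (chartAt (EuclideanSpace ℝ (Fin m)) x).target) : 0 < (metricMatrix x y).det :=
  (posDef_metricMatrix x hy).det_pos

theorem volumeDensity_pos (x : M) {y : EuclideanSpace ℝ (Fin m)}
    (hy : y ∈ (chartAt (EuclideanSpace ℝ (Fin m)) x).target) : 0 < volumeDensity x y :=
  Real.sqrt_pos.2 (det_metricMatrix_pos x hy)

variable [IsContMDiffRiemannianBundle (𝓡 m) ∞ (EuclideanSpace ℝ (Fin m))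
  (fun x : M ↦ TangentSpace (𝓡 m) x)]

theorem continuousOn_metricMatrix (x : M) :
    ContinuousOn (metricMatrix x) (chartAt (EuclideanSpace ℝ (Fin m)) x).target := by
  have : IsContinuousRiemannianBundle (EuclideanSpace ℝ (Fin m))
      (fun x : M ↦ TangentSpace (𝓡 m) x) := by
    obtain ⟨g, hg, h⟩ := IsContMDiffRiemannianBundle.exists_contMDiff (IB := 𝓡 m) (n := ∞)
      (F := EuclideanSpace ℝ (Fin m)) (E := fun x : M ↦ TangentSpace (𝓡 m) x)
    exact ⟨g, hg.continuous, h⟩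
  refine continuousOn_pi.2 fun i ↦ continuousOn_pi.2 fun j ↦ ?_
  exact ContinuousOn.inner_bundle (F := EuclideanSpace ℝ (Fin m))
    (E := fun x : M ↦ TangentSpace (𝓡 m) x)
    (continuousOn_coordVector x i) (continuousOn_coordVector x j)

theorem continuousOn_volumeDensity (x : M) :
    ContinuousOn (volumeDensity x) (chartAt (EuclideanSpace ℝ (Fin m)) x).target :=
  Real.continuous_sqrt.comp_continuousOn
    (continuous_id.matrix_det.comp_continuousOn (continuousOn_metricMatrix x))

end Frame

/-! ### Change of coordinates for the volume density. -/

/-- If `A` is the matrix of `J`, the Gram matrix changes from `G` to `Aᵀ G A`, so its determinant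
gains the factor `(det J)²`. -/
theorem sqrt_det_gram_comp {m : ℕ} {V : Type*} [NormedAddCommGroup V] [InnerProductSpace ℝ V]
    (L : EuclideanSpace ℝ (Fin m) →ₗ[ℝ] V)
    (J : EuclideanSpace ℝ (Fin m) →ₗ[ℝ] EuclideanSpace ℝ (Fin m)) :
    √(Matrix.gram ℝ fun i ↦ L (J (EuclideanSpace.single i 1))).det =
      |J.det| * √(Matrix.gram ℝ fun i ↦ L (EuclideanSpace.single i 1)).det := by
  set b := (EuclideanSpace.basisFun (Fin m) ℝ).toBasis
  have hb : ∀ i, b i = EuclideanSpace.single i (1 : ℝ) := fun i ↦ by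
    simp [b, OrthonormalBasis.coe_toBasis]
  set A := LinearMap.toMatrix b b J
  have hJ : ∀ i, J (EuclideanSpace.single i 1) =
      ∑ k, A k i • EuclideanSpace.single k (1 : ℝ) := fun i ↦ by
    rw [← hb, ← b.sum_repr (J (b i))]
    simp [A, LinearMap.toMatrix_apply, hb]
  have h : (Matrix.gram ℝ fun i ↦ L (J (EuclideanSpace.single i 1))) =
      A.transpose * (Matrix.gram ℝ fun i ↦ L (EuclideanSpace.single i 1)) * A := by
    ext i j
    simp only [Matrix.gram_apply, hJ, map_sum, map_smul, Matrix.mul_apply, Matrix.transpose_apply,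
      sum_inner, inner_sum, inner_smul_left, inner_smul_right, Finset.sum_mul, Finset.mul_sum,
      conj_trivial]
    refine Finset.sum_congr rfl fun k _ ↦ Finset.sum_congr rfl fun l _ ↦ ?_
    ring
  rw [h, Matrix.det_mul, Matrix.det_mul, Matrix.det_transpose, LinearMap.det_toMatrix,
    mul_right_comm, Real.sqrt_mul (mul_self_nonneg _), Real.sqrt_mul_self_eq_abs]

section Transition

variable {m : ℕ} {M : Type*} [TopologicalSpace M] [ChartedSpace (EuclideanSpace ℝ (Fin m)) M]

/-- The change of coordinates from the chart around `x'` to the chart around `x`. -/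
def transition (x x' : M) : EuclideanSpace ℝ (Fin m) → EuclideanSpace ℝ (Fin m) :=
  chartAt (EuclideanSpace ℝ (Fin m)) x ∘ (chartAt (EuclideanSpace ℝ (Fin m)) x').symm

/-- Two charts describe the same base point by terms that are only propositionally equal, so their
frames live in different tangent space types. This moves the density to the other base point. -/
theorem volumeDensity_eq_of_symm_eq [RiemannianBundle (fun x : M ↦ TangentSpace (𝓡 m) x)]
    {x : M} {y : EuclideanSpace ℝ (Fin m)} {z : M}
    (hz : (chartAt (EuclideanSpace ℝ (Fin m)) x).symm y = z)
    (v : Fin m → TangentSpace (𝓡 m) z)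
    (hv : ∀ i, (coordVector x y i : EuclideanSpace ℝ (Fin m)) = v i) :
    volumeDensity x y = √(Matrix.gram ℝ v).det := by
  subst hz
  obtain rfl : coordVector x y = v := funext hv
  rfl

variable [IsManifold (𝓡 m) ∞ M]

theorem differentiableAt_transition {x x' : M} {y : EuclideanSpace ℝ (Fin m)}
    (hy : y ∈ (chartAt (EuclideanSpace ℝ (Fin m)) x').target)
    (hy' : (chartAt (EuclideanSpace ℝ (Fin m)) x').symm y ∈
      (chartAt (EuclideanSpace ℝ (Fin m)) x).source) :
    DifferentiableAt ℝ (transition x x') y :=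
  (((mdifferentiable_chart (I := 𝓡 m) x).mdifferentiableAt hy').comp y
    (mdifferentiableAt_chart_symm x' hy)).differentiableAt

theorem coordVector_eq_transition {x x' : M} {y : EuclideanSpace ℝ (Fin m)}
    (hy : y ∈ (chartAt (EuclideanSpace ℝ (Fin m)) x').target)
    (hy' : (chartAt (EuclideanSpace ℝ (Fin m)) x').symm y ∈
      (chartAt (EuclideanSpace ℝ (Fin m)) x).source) (i : Fin m) :
    (coordVector x' y i : EuclideanSpace ℝ (Fin m)) =
      mfderiv (𝓡 m) (𝓡 m) (chartAt (EuclideanSpace ℝ (Fin m)) x).symm (transition x x' y)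
        (fderiv ℝ (transition x x') y (EuclideanSpace.single i 1)) := by
  set φ := chartAt (EuclideanSpace ℝ (Fin m)) x
  set ψ := chartAt (EuclideanSpace ℝ (Fin m)) x'
  have hT := differentiableAt_transition hy hy'
  have hmem : transition x x' y ∈ φ.target := φ.map_source hy'
  have hev : φ.symm ∘ transition x x' =ᶠ[nhds y] ψ.symm := by
    filter_upwards [(ψ.symm.continuousAt hy).preimage_mem_nhds (φ.open_source.mem_nhds hy')]
      with w hw using φ.left_inv hw
  have h := HasMFDerivAt.comp y (mdifferentiableAt_chart_symm x hmem).hasMFDerivAt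
    hT.hasFDerivAt.hasMFDerivAt
  have h' := (h.congr_of_eventuallyEq hev.symm).mfderiv
  unfold coordVector
  rw [h']
  rfl

theorem volumeDensity_eq_transition [RiemannianBundle (fun x : M ↦ TangentSpace (𝓡 m) x)]
    {x x' : M} {y : EuclideanSpace ℝ (Fin m)}
    (hy : y ∈ (chartAt (EuclideanSpace ℝ (Fin m)) x').target)
    (hy' : (chartAt (EuclideanSpace ℝ (Fin m)) x').symm y ∈
      (chartAt (EuclideanSpace ℝ (Fin m)) x).source) :
    volumeDensity x' y =
      |(fderiv ℝ (transition x x') y).det| * volumeDensity x (transition x x' y) := by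
  have hz : (chartAt (EuclideanSpace ℝ (Fin m)) x').symm y =
      (chartAt (EuclideanSpace ℝ (Fin m)) x).symm (transition x x' y) :=
    ((chartAt (EuclideanSpace ℝ (Fin m)) x).left_inv hy').symm
  rw [volumeDensity_eq_of_symm_eq hz _ fun i ↦ coordVector_eq_transition hy hy' i]
  exact sqrt_det_gram_comp (V := TangentSpace (𝓡 m)
    ((chartAt (EuclideanSpace ℝ (Fin m)) x).symm (transition x x' y)))
    (mfderiv (𝓡 m) (𝓡 m) (chartAt (EuclideanSpace ℝ (Fin m)) x).symm
      (transition x x' y)).toLinearMap (fderiv ℝ (transition x x') y).toLinearMap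

end Transition

/-! ### The Riemannian volume: local finiteness and positivity on open sets. -/

section Volume

variable {m : ℕ} {M : Type*} [TopologicalSpace M] [ChartedSpace (EuclideanSpace ℝ (Fin m)) M]
  [MeasurableSpace M] [BorelSpace M]

theorem measurableSet_chart_preimage (x : M) {A : Set M} (hA : MeasurableSet A) :
    MeasurableSet ((chartAt (EuclideanSpace ℝ (Fin m)) x).symm ⁻¹' A ∩
      (chartAt (EuclideanSpace ℝ (Fin m)) x).target) := by
  set φ := chartAt (EuclideanSpace ℝ (Fin m)) x
  have h := φ.open_target.measurableSet.subtype_image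
    ((continuousOn_iff_continuous_domRestrict.1 φ.continuousOn_symm).measurable hA)
  convert h using 1
  ext y
  simp [and_comm]

variable [RiemannianBundle (fun x : M ↦ TangentSpace (𝓡 m) x)]

theorem chartVolume_apply (x : M) {A : Set M} (hA : MeasurableSet A) :
    chartVolume m x A = ∫⁻ y in (chartAt (EuclideanSpace ℝ (Fin m)) x).symm ⁻¹' A ∩
      (chartAt (EuclideanSpace ℝ (Fin m)) x).target, ENNReal.ofReal (volumeDensity x y) := by
  set φ := chartAt (EuclideanSpace ℝ (Fin m)) x
  have hφ : AEMeasurable φ.symm (((volume : Measure (EuclideanSpace ℝ (Fin m))).restrict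
      φ.target).withDensity fun y ↦ ENNReal.ofReal (volumeDensity x y)) :=
    (φ.continuousOn_symm.aemeasurable φ.open_target.measurableSet).mono_ac
      (withDensity_absolutelyContinuous _ _)
  rw [chartVolume, Measure.map_apply_of_aemeasurable hφ hA, withDensity_apply',
    Measure.restrict_restrict' φ.open_target.measurableSet]

variable [IsManifold (𝓡 m) ∞ M]

/-- Change of variables along the transition map. Only an inequality holds, since `A` may leave the
chart domain of `x'`; it suffices for bounding the supremum. -/
theorem chartVolume_le_of_subset_source {x x' : M} {A : Set M} (hA : MeasurableSet A)
    (hAx : A ⊆ (chartAt (EuclideanSpace ℝ (Fin m)) x).source) :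
    chartVolume m x' A ≤ chartVolume m x A := by
  rw [chartVolume_apply x' hA, chartVolume_apply x hA]
  set φ := chartAt (EuclideanSpace ℝ (Fin m)) x
  set ψ := chartAt (EuclideanSpace ℝ (Fin m)) x'
  set S := ψ.symm ⁻¹' A ∩ ψ.target
  have hS : MeasurableSet S := measurableSet_chart_preimage x' hA
  have himage : transition x x' '' S ⊆ φ.symm ⁻¹' A ∩ φ.target := by
    rintro _ ⟨y, hy, rfl⟩
    refine ⟨?_, φ.map_source (hAx hy.1)⟩
    change φ.symm (φ (ψ.symm y)) ∈ A
    rw [φ.left_inv (hAx hy.1)]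
    exact hy.1
  have hinj : Set.InjOn (transition x x') S := fun y hy z hz h ↦
    ψ.symm.injOn hy.2 hz.2 (φ.injOn (hAx hy.1) (hAx hz.1) h)
  calc ∫⁻ y in S, ENNReal.ofReal (volumeDensity x' y)
      = ∫⁻ y in S, ENNReal.ofReal |(fderiv ℝ (transition x x') y).det| *
          ENNReal.ofReal (volumeDensity x (transition x x' y)) := by
        refine setLIntegral_congr_fun hS fun y hy ↦ ?_
        rw [← ENNReal.ofReal_mul (abs_nonneg _),
          volumeDensity_eq_transition hy.2 (hAx hy.1)]
    _ = ∫⁻ y in transition x x' '' S, ENNReal.ofReal (volumeDensity x y) :=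
        (lintegral_image_eq_lintegral_abs_det_fderiv_mul volume hS (fun y hy ↦
          (differentiableAt_transition hy.2 (hAx hy.1)).hasFDerivAt.hasFDerivWithinAt) hinj
          fun y ↦ ENNReal.ofReal (volumeDensity x y)).symm
    _ ≤ _ := lintegral_mono_set himage

/-- A supremum of measures is not computed set by set, so a single measure dominating every chart
volume is used: the volume of this chart plus infinite mass off its domain. The second term does not
see `A`. -/
theorem riemannianVolume_le_of_subset_source {x : M} {A : Set M} (hA : MeasurableSet A)
    (hAx : A ⊆ (chartAt (EuclideanSpace ℝ (Fin m)) x).source) :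
    riemannianVolume m M A ≤ chartVolume m x A := by
  set U := (chartAt (EuclideanSpace ℝ (Fin m)) x).source
  have hU : MeasurableSet U := (chartAt (EuclideanSpace ℝ (Fin m)) x).open_source.measurableSet
  have hle : riemannianVolume m M ≤ chartVolume m x + (⊤ : Measure M).restrict Uᶜ := by
    refine iSup_le fun x' ↦ Measure.le_iff.2 fun s hs ↦ ?_
    rw [← measure_inter_add_sdiff s hU, Measure.add_apply, Measure.restrict_apply hs]
    refine add_le_add ?_ ?_
    · exact (chartVolume_le_of_subset_source (hs.inter hU) Set.inter_subset_right).trans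
        (measure_mono Set.inter_subset_left)
    · exact (le_top : chartVolume m x' ≤ ⊤) _
  refine (hle A).trans_eq ?_
  rw [Measure.add_apply, Measure.restrict_apply hA,
    Set.disjoint_iff_inter_eq_empty.1 (Set.disjoint_compl_right_iff_subset.2 hAx),
    measure_empty, add_zero]

variable [IsContMDiffRiemannianBundle (𝓡 m) ∞ (EuclideanSpace ℝ (Fin m))
  (fun x : M ↦ TangentSpace (𝓡 m) x)]

theorem isLocallyFiniteMeasure_riemannianVolume :
    IsLocallyFiniteMeasure (riemannianVolume m M) := by
  refine ⟨fun x ↦ ?_⟩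
  set φ := chartAt (EuclideanSpace ℝ (Fin m)) x
  have hx : φ x ∈ φ.target := mem_chart_target _ x
  have hρ : ContinuousAt (volumeDensity x) (φ x) :=
    (continuousOn_volumeDensity x).continuousAt (φ.open_target.mem_nhds hx)
  obtain ⟨r, hr, hball⟩ := Metric.mem_nhds_iff.1 (Filter.inter_mem (φ.open_target.mem_nhds hx)
    (hρ.eventually (gt_mem_nhds (lt_add_one (volumeDensity x (φ x))))))
  have hopen := φ.isOpen_inter_preimage (Metric.isOpen_ball (x := φ x) (ε := r))
  refine ⟨φ.source ∩ φ ⁻¹' Metric.ball (φ x) r,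
    hopen.mem_nhds ⟨mem_chart_source _ x, Metric.mem_ball_self hr⟩, ?_⟩
  refine (riemannianVolume_le_of_subset_source hopen.measurableSet
    Set.inter_subset_left).trans_lt ?_
  rw [chartVolume_apply x hopen.measurableSet]
  have hsub : φ.symm ⁻¹' (φ.source ∩ φ ⁻¹' Metric.ball (φ x) r) ∩ φ.target ⊆
      Metric.ball (φ x) r := fun y hy ↦ by
    have := hy.1.2
    rwa [Set.mem_preimage, φ.right_inv hy.2] at this
  refine (lintegral_mono_set hsub).trans_lt ?_
  refine (setLIntegral_mono' measurableSet_ball fun y hy ↦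
    ENNReal.ofReal_le_ofReal (hball hy).2.le).trans_lt ?_
  rw [setLIntegral_const]
  exact ENNReal.mul_lt_top ENNReal.ofReal_lt_top measure_ball_lt_top

/-- One chart already bounds the supremum from below, and its density is positive, so a null open
set would have a Lebesgue-null open image. -/
theorem isOpenPosMeasure_riemannianVolume :
    (riemannianVolume m M).IsOpenPosMeasure := by
  refine ⟨fun U hU ⟨x, hx⟩ h0 ↦ ?_⟩
  set φ := chartAt (EuclideanSpace ℝ (Fin m)) x
  have h0' : chartVolume m x U = 0 :=
    le_antisymm (h0 ▸ le_iSup (fun x ↦ chartVolume m x) x U) zero_le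
  rw [chartVolume_apply x hU.measurableSet, Set.inter_comm] at h0'
  have hopen : IsOpen (φ.target ∩ φ.symm ⁻¹' U) := φ.symm.isOpen_inter_preimage hU
  have hmeas : AEMeasurable (fun y ↦ ENNReal.ofReal (volumeDensity x y))
      (volume.restrict (φ.target ∩ φ.symm ⁻¹' U)) :=
    (((continuousOn_volumeDensity x).mono Set.inter_subset_left).aemeasurable
      hopen.measurableSet).ennreal_ofReal
  have hae := (setLIntegral_eq_zero_iff' hopen.measurableSet hmeas).1 h0'
  have hnull : volume (φ.target ∩ φ.symm ⁻¹' U) = 0 := by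
    refine measure_mono_null (fun y hy ↦ ?_) hae
    simp only [Set.mem_compl_iff, Set.mem_ofPred_eq, not_forall]
    exact ⟨hy, (ENNReal.ofReal_pos.2 (volumeDensity_pos x hy.1)).ne'⟩
  refine (hopen.measure_pos volume ⟨φ x, mem_chart_target _ x, ?_⟩).ne' hnull
  rwa [Set.mem_preimage, φ.left_inv (mem_chart_source _ x)]

end Volume

/-! ### The energy density in coordinates and the first variation. -/

/-- With `P` the coefficients of `v` in the orthonormal basis, `G = P Pᵀ`, hence `Pᵀ G⁻¹ P = 1`;
inserting this identity turns one sum into the other. The point is to eliminate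
`stdOrthonormalBasis`, whose choice need not depend continuously on the base point. -/
theorem sum_norm_sq_eq_sum_gram_inv {m : ℕ} {V W : Type*} [NormedAddCommGroup V]
    [InnerProductSpace ℝ V] [FiniteDimensional ℝ V] [NormedAddCommGroup W] [InnerProductSpace ℝ W]
    (hm : Module.finrank ℝ V = m) {v : Fin m → V} (hv : (Matrix.gram ℝ v).PosDef)
    (L : V →ₗ[ℝ] W) :
    ∑ k, ‖L (stdOrthonormalBasis ℝ V k)‖ ^ 2 =
      ∑ i, ∑ j, (Matrix.gram ℝ v)⁻¹ i j * inner ℝ (L (v i)) (L (v j)) := by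
  subst hm
  set e := stdOrthonormalBasis ℝ V
  set G := Matrix.gram ℝ v
  set P : Matrix _ _ ℝ := Matrix.of fun i k ↦ inner ℝ (e k) (v i)
  have hvP : ∀ i, v i = ∑ k, P i k • e k := fun i ↦ (e.sum_repr' (v i)).symm
  have hG : G = P * P.transpose := by
    ext i j
    simp only [G, P, Matrix.gram_apply, Matrix.mul_apply, Matrix.transpose_apply, Matrix.of_apply]
    rw [← e.sum_inner_mul_inner (v i) (v j)]
    exact Finset.sum_congr rfl fun k _ ↦ by rw [real_inner_comm]
  have hP : IsUnit P.det := by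
    have h := hv.det_pos.ne'
    change G.det ≠ 0 at h
    rw [hG, Matrix.det_mul] at h
    exact isUnit_iff_ne_zero.2 (left_ne_zero_of_mul h)
  have hPt : IsUnit P.transpose.det := by rwa [Matrix.det_transpose]
  have h1 : P.transpose * G⁻¹ * P = 1 := by
    rw [hG, Matrix.mul_inv_rev, ← Matrix.mul_assoc, Matrix.mul_nonsing_inv _ hPt, Matrix.one_mul,
      Matrix.nonsing_inv_mul _ hP]
  have h2 : ∀ k l, ∑ i, ∑ j, P i k * G⁻¹ i j * P j l = (1 : Matrix _ _ ℝ) k l := fun k l ↦ by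
    rw [← h1, Matrix.mul_apply, Finset.sum_comm]
    exact Finset.sum_congr rfl fun j _ ↦ by
      rw [Matrix.mul_apply, Finset.sum_mul]
      rfl
  calc ∑ k, ‖L (e k)‖ ^ 2
      = ∑ k, ∑ l, (1 : Matrix _ _ ℝ) k l * inner ℝ (L (e k)) (L (e l)) := by
        simp [Matrix.one_apply]
    _ = ∑ k, ∑ l, ∑ i, ∑ j, G⁻¹ i j * (P i k * P j l * inner ℝ (L (e k)) (L (e l))) := by
        refine Finset.sum_congr rfl fun k _ ↦ Finset.sum_congr rfl fun l _ ↦ ?_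
        simp only [← h2, Finset.sum_mul]
        exact Finset.sum_congr rfl fun i _ ↦ Finset.sum_congr rfl fun j _ ↦ by ring
    _ = ∑ i, ∑ j, ∑ k, ∑ l, G⁻¹ i j * (P i k * P j l * inner ℝ (L (e k)) (L (e l))) := by
        simp only [← Finset.sum_product' Finset.univ Finset.univ]
        exact Finset.sum_comm
    _ = _ := by
        refine Finset.sum_congr rfl fun i _ ↦ Finset.sum_congr rfl fun j _ ↦ ?_
        rw [hvP i, hvP j]
        simp only [map_sum, map_smul, sum_inner, inner_sum, inner_smul_left, inner_smul_right,
          conj_trivial, Finset.mul_sum]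
        rw [Finset.sum_comm]
        exact Finset.sum_congr rfl fun k _ ↦ Finset.sum_congr rfl fun l _ ↦ by ring

theorem differential_mfderiv_chart_symm {m n : ℕ} {M : Type*} [TopologicalSpace M]
    [ChartedSpace (EuclideanSpace ℝ (Fin m)) M] [IsManifold (𝓡 m) ∞ M]
    {f : M → EuclideanSpace ℝ (Fin n)} (hf : ContMDiff (𝓡 m) (𝓡 n) ∞ f) (x : M)
    {y : EuclideanSpace ℝ (Fin m)} (hy : y ∈ (chartAt (EuclideanSpace ℝ (Fin m)) x).target)
    (w : EuclideanSpace ℝ (Fin m)) :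
    differential m f ((chartAt (EuclideanSpace ℝ (Fin m)) x).symm y)
        (mfderiv (𝓡 m) (𝓡 m) (chartAt (EuclideanSpace ℝ (Fin m)) x).symm y w) =
      fderiv ℝ (f ∘ (chartAt (EuclideanSpace ℝ (Fin m)) x).symm) y w := by
  have h := (HasMFDerivAt.comp y ((hf.mdifferentiable (by simp)) _).hasMFDerivAt
    (mdifferentiableAt_chart_symm x hy).hasMFDerivAt).mfderiv
  rw [mfderiv_eq_fderiv] at h
  exact (congrArg (fun L : EuclideanSpace ℝ (Fin m) →L[ℝ] EuclideanSpace ℝ (Fin n) ↦ L w) h).symm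

section Energy

variable {m n : ℕ} {M : Type*} [TopologicalSpace M] [ChartedSpace (EuclideanSpace ℝ (Fin m)) M]
  [RiemannianBundle (fun x : M ↦ TangentSpace (𝓡 m) x)]

/-- The pairing `⟨df, dφ⟩` of differentials polarizing `‖df‖²`. -/
def innerDifferential (m : ℕ) {n : ℕ} {M : Type*} [TopologicalSpace M]
    [ChartedSpace (EuclideanSpace ℝ (Fin m)) M]
    [RiemannianBundle (fun x : M ↦ TangentSpace (𝓡 m) x)]
    (f φ : M → EuclideanSpace ℝ (Fin n)) (x : M) : ℝ :=
  ∑ i, inner ℝ (differential m f x (stdOrthonormalBasis ℝ (TangentSpace (𝓡 m) x) i))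
    (differential m φ x (stdOrthonormalBasis ℝ (TangentSpace (𝓡 m) x) i))

theorem normSqDifferential_add_smul {f φ : M → EuclideanSpace ℝ (Fin n)} {x : M}
    (hf : MDifferentiableAt (𝓡 m) (𝓡 n) f x) (hφ : MDifferentiableAt (𝓡 m) (𝓡 n) φ x) (t : ℝ) :
    normSqDifferential m (fun x ↦ f x + t • φ x) x = normSqDifferential m f x +
      2 * t * innerDifferential m f φ x + t ^ 2 * normSqDifferential m φ x := by
  have h : ∀ v, differential m (fun x ↦ f x + t • φ x) x v =
      differential m f x v + t • differential m φ x v := fun v ↦ by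
    have := (hf.hasMFDerivAt.add (hφ.hasMFDerivAt.const_smul t)).mfderiv
    exact congrArg (fun L ↦ L v) this
  simp only [normSqDifferential, innerDifferential, Finset.mul_sum, ← Finset.sum_add_distrib, h]
  refine Finset.sum_congr rfl fun i _ ↦ ?_
  rw [norm_add_sq_real, inner_smul_right, norm_smul, mul_pow, Real.norm_eq_abs, sq_abs]
  ring

variable [IsManifold (𝓡 m) ∞ M]

theorem normSqDifferential_chart {f : M → EuclideanSpace ℝ (Fin n)}
    (hf : ContMDiff (𝓡 m) (𝓡 n) ∞ f) (x : M) {y : EuclideanSpace ℝ (Fin m)}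
    (hy : y ∈ (chartAt (EuclideanSpace ℝ (Fin m)) x).target) :
    normSqDifferential m f ((chartAt (EuclideanSpace ℝ (Fin m)) x).symm y) =
      ∑ i, ∑ j, (metricMatrix x y)⁻¹ i j *
        inner ℝ (fderiv ℝ (f ∘ (chartAt (EuclideanSpace ℝ (Fin m)) x).symm) y
          (EuclideanSpace.single i 1))
        (fderiv ℝ (f ∘ (chartAt (EuclideanSpace ℝ (Fin m)) x).symm) y
          (EuclideanSpace.single j 1)) := by
  simp only [← differential_mfderiv_chart_symm hf x hy]
  exact sum_norm_sq_eq_sum_gram_inv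
    (V := TangentSpace (𝓡 m) ((chartAt (EuclideanSpace ℝ (Fin m)) x).symm y))
    finrank_euclideanSpace_fin (posDef_metricMatrix x hy)
    (differential m f ((chartAt (EuclideanSpace ℝ (Fin m)) x).symm y)).toLinearMap

variable [IsContMDiffRiemannianBundle (𝓡 m) ∞ (EuclideanSpace ℝ (Fin m))
  (fun x : M ↦ TangentSpace (𝓡 m) x)]

theorem continuous_normSqDifferential {f : M → EuclideanSpace ℝ (Fin n)}
    (hf : ContMDiff (𝓡 m) (𝓡 n) ∞ f) : Continuous (normSqDifferential m f) := by
  refine continuous_iff_continuousAt.2 fun x ↦ ?_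
  set e := chartAt (EuclideanSpace ℝ (Fin m)) x
  have hcd : ContDiffOn ℝ ∞ (f ∘ e.symm) e.target :=
    (hf.comp_contMDiffOn (contMDiffOn_chart_symm (I := 𝓡 m) (x := x))).contDiffOn
  have hd : ContinuousOn (fderiv ℝ (f ∘ e.symm)) e.target :=
    hcd.continuousOn_fderiv_of_isOpen e.open_target (by simp)
  have hinv : ContinuousOn (fun y ↦ (metricMatrix x y)⁻¹) e.target := by
    simp only [Matrix.inv_def, Ring.inverse_eq_inv']
    refine ContinuousOn.smul (ContinuousOn.inv₀ ?_ fun y hy ↦ (det_metricMatrix_pos x hy).ne')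
      (continuous_id.matrix_adjugate.comp_continuousOn (continuousOn_metricMatrix x))
    exact continuous_id.matrix_det.comp_continuousOn (continuousOn_metricMatrix x)
  have hF : ContinuousOn (fun y ↦ normSqDifferential m f (e.symm y)) e.target := by
    refine ContinuousOn.congr ?_ fun y hy ↦ normSqDifferential_chart hf x hy
    refine continuousOn_finsetSum _ fun i _ ↦ continuousOn_finsetSum _ fun j _ ↦ ?_
    exact (continuousOn_pi.1 (continuousOn_pi.1 hinv i) j).mul
      (ContinuousOn.inner (𝕜 := ℝ) (hd.clm_apply continuousOn_const)
        (hd.clm_apply continuousOn_const))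
  refine ((hF.comp e.continuousOn fun z hz ↦ e.map_source hz).congr fun z hz ↦ ?_).continuousAt
    (e.open_source.mem_nhds (mem_chart_source _ x))
  simp only [Function.comp_apply, e.left_inv hz]

theorem continuous_innerDifferential {f φ : M → EuclideanSpace ℝ (Fin n)}
    (hf : ContMDiff (𝓡 m) (𝓡 n) ∞ f) (hφ : ContMDiff (𝓡 m) (𝓡 n) ∞ φ) :
    Continuous (innerDifferential m f φ) := by
  have h : innerDifferential m f φ = fun x ↦ (normSqDifferential m (fun x ↦ f x + (1 : ℝ) • φ x) x
      - normSqDifferential m f x - normSqDifferential m φ x) / 2 := funext fun x ↦ by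
    rw [normSqDifferential_add_smul (hf.mdifferentiable (by simp) x)
      (hφ.mdifferentiable (by simp) x)]
    ring
  rw [h]
  have hsum : ContMDiff (𝓡 m) (𝓡 n) ∞ fun x ↦ f x + (1 : ℝ) • φ x := by
    simp only [one_smul]
    exact hf.add hφ
  exact (((continuous_normSqDifferential hsum).sub (continuous_normSqDifferential hf)).sub
    (continuous_normSqDifferential hφ)).div_const 2

variable [MeasurableSpace M] [BorelSpace M] [T2Space M]

/-- Along `f + t φ` the energy is a quadratic polynomial in `t`, whose linear coefficient is this
integral. Local finiteness of the volume makes the three coefficients integrable on the compact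
support. -/
theorem IsHarmonicMap.setIntegral_innerDifferential_eq_zero {f φ : M → EuclideanSpace ℝ (Fin n)}
    (hf : IsHarmonicMap m f) (hφ : ContMDiff (𝓡 m) (𝓡 n) ∞ φ) (hφc : HasCompactSupport φ) :
    ∫ x in tsupport φ, innerDifferential m f φ x ∂(riemannianVolume m M) = 0 := by
  have := isLocallyFiniteMeasure_riemannianVolume (m := m) (M := M)
  have hint : ∀ g : M → ℝ, Continuous g →
      Integrable g ((riemannianVolume m M).restrict (tsupport φ)) := fun g hg ↦
    hg.continuousOn.integrableOn_compact hφc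
  have hE : (fun t : ℝ ↦ dirichletEnergy m (tsupport φ) (fun x ↦ f x + t • φ x)) = fun t ↦
      (1 / 2) * ((∫ x in tsupport φ, normSqDifferential m f x ∂(riemannianVolume m M)) +
      2 * t * (∫ x in tsupport φ, innerDifferential m f φ x ∂(riemannianVolume m M)) +
      t ^ 2 * ∫ x in tsupport φ, normSqDifferential m φ x ∂(riemannianVolume m M)) := by
    funext t
    have h1 := hint _ (continuous_normSqDifferential hf.1)
    have h2 := (hint _ (continuous_innerDifferential hf.1 hφ)).const_mul (2 * t)
    have h3 := (hint _ (continuous_normSqDifferential hφ)).const_mul (t ^ 2)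
    have h12 : Integrable (fun x ↦ normSqDifferential m f x + 2 * t * innerDifferential m f φ x)
        ((riemannianVolume m M).restrict (tsupport φ)) := h1.add h2
    rw [dirichletEnergy, ← integral_const_mul (2 * t), ← integral_const_mul (t ^ 2),
      ← integral_add h1 h2, ← integral_add h12 h3]
    refine congrArg _ (integral_congr_ae (Filter.Eventually.of_forall fun x ↦ ?_))
    exact normSqDifferential_add_smul (hf.1.mdifferentiable (by simp) x)
      (hφ.mdifferentiable (by simp) x) t
  have h0 := hf.2 φ hφ hφc
  rw [hE] at h0
  set a := ∫ x in tsupport φ, normSqDifferential m f x ∂(riemannianVolume m M)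
  set b := ∫ x in tsupport φ, innerDifferential m f φ x ∂(riemannianVolume m M)
  set c := ∫ x in tsupport φ, normSqDifferential m φ x ∂(riemannianVolume m M)
  have h1 : HasDerivAt (fun t : ℝ ↦ (1 / 2) * (a + 2 * t * b + t ^ 2 * c)) b 0 := by
    have hid := hasDerivAt_id (0 : ℝ)
    have := (((hid.const_mul 2).mul_const b).const_add a).add ((hid.pow 2).mul_const c)
    exact (this.const_mul (1 / 2)).congr_deriv (by simp)
  exact h1.unique h0

/-- If the pairing of the differential of a harmonic map with a variation is nonnegative, then it
vanishes identically. -/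
theorem IsHarmonicMap.innerDifferential_eq_zero {f φ : M → EuclideanSpace ℝ (Fin n)}
    (hf : IsHarmonicMap m f) (hφ : ContMDiff (𝓡 m) (𝓡 n) ∞ φ) (hφc : HasCompactSupport φ)
    (hnn : ∀ x, 0 ≤ innerDifferential m f φ x) (x : M) : innerDifferential m f φ x = 0 := by
  have := isLocallyFiniteMeasure_riemannianVolume (m := m) (M := M)
  have := isOpenPosMeasure_riemannianVolume (m := m) (M := M)
  have hcont := continuous_innerDifferential hf.1 hφ
  have hoff : ∀ x ∉ tsupport φ, innerDifferential m f φ x = 0 := fun x hx ↦ by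
    have hev : φ =ᶠ[nhds x] fun _ ↦ 0 := notMem_tsupport_iff_eventuallyEq.1 hx
    have hd : differential m φ x = 0 := by
      rw [differential, hev.mfderiv_eq, mfderiv_const]
      rfl
    simp [innerDifferential, hd]
  have h0 := (integral_eq_zero_iff_of_nonneg hnn
    (hcont.continuousOn.integrableOn_compact hφc)).1
    (hf.setIntegral_innerDifferential_eq_zero hφ hφc)
  have hae : innerDifferential m f φ =ᵐ[riemannianVolume m M] fun _ ↦ 0 := by
    filter_upwards [(ae_restrict_iff' (isClosed_tsupport φ).measurableSet).1 h0] with x hx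
    by_cases hxs : x ∈ tsupport φ
    · exact hx hxs
    · exact hoff x hxs
  exact congrFun (Continuous.ae_eq_iff_eq _ hcont continuous_const |>.1 hae) x

end Energy

/-! ### Locally constant heights, boundaries of components, and the cutoff function. -/

theorem eventually_inner_eq_of_inner_differential_eq_zero {m n : ℕ} {M : Type*}
    [TopologicalSpace M] [ChartedSpace (EuclideanSpace ℝ (Fin m)) M] [IsManifold (𝓡 m) ∞ M]
    {f : M → EuclideanSpace ℝ (Fin n)} (hf : ContMDiff (𝓡 m) (𝓡 n) ∞ f)
    {ν : EuclideanSpace ℝ (Fin n)} {x₀ : M}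
    (h : ∀ᶠ x in nhds x₀, ∀ v, inner ℝ ν (differential m f x v) = 0) :
    ∀ᶠ x in nhds x₀, inner ℝ ν (f x) = inner ℝ ν (f x₀) := by
  set e := chartAt (EuclideanSpace ℝ (Fin m)) x₀
  have hx₀ : x₀ ∈ e.source := mem_chart_source _ x₀
  have ht : e x₀ ∈ e.target := e.map_source hx₀
  have htend : Filter.Tendsto e.symm (nhds (e x₀)) (nhds x₀) := by
    simpa only [ContinuousAt, e.left_inv hx₀] using e.symm.continuousAt ht
  obtain ⟨r, hr, hball⟩ := Metric.mem_nhds_iff.1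
    (Filter.inter_mem (e.open_target.mem_nhds ht) (htend.eventually h))
  have hcd : ContDiffOn ℝ ∞ (f ∘ e.symm) e.target :=
    (hf.comp_contMDiffOn (contMDiffOn_chart_symm (I := 𝓡 m) (x := x₀))).contDiffOn
  have hd : ∀ y ∈ Metric.ball (e x₀) r, HasFDerivAt (fun y ↦ inner ℝ ν (f (e.symm y)))
      ((innerSL ℝ ν).comp (fderiv ℝ (f ∘ e.symm) y)) y := fun y hy ↦
    (innerSL ℝ ν).hasFDerivAt.comp y ((hcd.differentiableOn (by simp)).differentiableAt
      (e.open_target.mem_nhds (hball hy).1)).hasFDerivAt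
  have hconst : ∀ y ∈ Metric.ball (e x₀) r,
      inner ℝ ν (f (e.symm y)) = inner ℝ ν (f (e.symm (e x₀))) := fun y hy ↦ by
    refine Metric.isOpen_ball.is_const_of_fderiv_eq_zero (𝕜 := ℝ)
      (convex_ball _ _).isPreconnected
      (fun z hz ↦ (hd z hz).differentiableAt.differentiableWithinAt) (fun z hz ↦ ?_) hy
      (Metric.mem_ball_self hr)
    rw [(hd z hz).fderiv]
    ext w
    rw [ContinuousLinearMap.comp_apply, innerSL_apply_apply,
      ← differential_mfderiv_chart_symm hf x₀ (hball hz).1]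
    exact (hball hz).2 _
  filter_upwards [e.open_source.mem_nhds hx₀,
    (e.continuousAt hx₀).preimage_mem_nhds (Metric.ball_mem_nhds _ hr)] with x hx hxb
  simpa only [e.left_inv hx, e.left_inv hx₀] using hconst (e x) hxb

/-- A frontier point in `F` would have its own component as an open neighbourhood. That component
meets the one of `b`, so the two coincide, and the point would be interior. -/
theorem frontier_connectedComponentIn_subset {X : Type*} [TopologicalSpace X]
    [LocallyConnectedSpace X] {F : Set X} (hF : IsOpen F) (b : X) :
    frontier (connectedComponentIn F b) ⊆ Fᶜ := by
  intro y hy hyF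
  rw [hF.connectedComponentIn.frontier_eq] at hy
  obtain ⟨z, hzy, hzb⟩ := mem_closure_iff.1 hy.1 _ hF.connectedComponentIn
    (mem_connectedComponentIn hyF)
  refine hy.2 ?_
  rw [connectedComponentIn_eq hzb, ← connectedComponentIn_eq hzy]
  exact mem_connectedComponentIn hyF

/-- A connected set missing a hyperplane lies on one side of it. -/
theorem IsHyperplane.exists_lt_inner {n : ℕ} {H B : Set (EuclideanSpace ℝ (Fin n))}
    (hH : IsHyperplane H) (hB : IsPreconnected B) (hdisj : Disjoint B H) :
    ∃ (ν : EuclideanSpace ℝ (Fin n)) (c : ℝ), (∀ y ∈ B, c < inner ℝ ν y) ∧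
      ∀ y ∈ H, inner ℝ ν y = c := by
  obtain ⟨ν, -, c, rfl⟩ := hH
  have hne : ∀ y ∈ B, inner ℝ ν y ≠ c := fun y hy h ↦ Set.disjoint_left.1 hdisj hy h
  have hcont : ContinuousOn (fun y ↦ inner ℝ ν y) B := by fun_prop
  by_cases h : ∀ y ∈ B, c < inner ℝ ν y
  · exact ⟨ν, c, h, fun y hy ↦ hy⟩
  · push Not at h
    obtain ⟨y, hy, hyc⟩ := h
    -- Some point of `B` is below the hyperplane; flip the normal. A point on the other side would
    -- force a crossing by the intermediate value theorem.
    refine ⟨-ν, -c, fun z hz ↦ ?_, fun z hz ↦ by rw [inner_neg_left]; exact congrArg _ hz⟩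
    rw [inner_neg_left, neg_lt_neg_iff]
    by_contra! hzc
    obtain ⟨w, hw, hwc⟩ := hB.intermediate_value hy hz hcont ⟨hyc, hzc⟩
    exact hne w hw hwc

theorem deriv_expNegInvGlue_nonneg (s : ℝ) : 0 ≤ deriv expNegInvGlue s :=
  expNegInvGlue.monotone.deriv_nonneg

theorem deriv_expNegInvGlue_pos {s : ℝ} (hs : 0 < s) : 0 < deriv expNegInvGlue s := by
  have hev : expNegInvGlue =ᶠ[nhds s] fun x ↦ Real.exp (-x⁻¹) := by
    filter_upwards [lt_mem_nhds hs] with x hx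
    simp [expNegInvGlue, hx.not_ge]
  have hd : HasDerivAt (fun x ↦ Real.exp (-x⁻¹)) (Real.exp (-s⁻¹) * -(-(s ^ 2)⁻¹)) s :=
    (hasDerivAt_inv hs.ne').neg.exp
  rw [hev.deriv_eq, hd.deriv, neg_neg]
  have := Real.exp_pos (-s⁻¹)
  positivity

/-! ### Rigidity of harmonic maps. -/

section Final

variable {m n : ℕ} {M : Type*} [TopologicalSpace M] [ChartedSpace (EuclideanSpace ℝ (Fin m)) M]
  [RiemannianBundle (fun x : M ↦ TangentSpace (𝓡 m) x)]

theorem inner_differential_eq_zero_of_basis {f : M → EuclideanSpace ℝ (Fin n)} {x : M}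
    {ν : EuclideanSpace ℝ (Fin n)}
    (h : ∀ i, inner ℝ ν
      (differential m f x (stdOrthonormalBasis ℝ (TangentSpace (𝓡 m) x) i)) = 0)
    (v : TangentSpace (𝓡 m) x) : inner ℝ ν (differential m f x v) = 0 := by
  have h0 : ((innerSL ℝ ν).comp (differential m f x)).toLinearMap = 0 :=
    (stdOrthonormalBasis ℝ (TangentSpace (𝓡 m) x)).toBasis.ext fun i ↦ by
      simpa using h i
  exact LinearMap.congr_fun h0 v

variable [IsManifold (𝓡 m) ∞ M] [IsContMDiffRiemannianBundle (𝓡 m) ∞ (EuclideanSpace ℝ (Fin m))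
  (fun x : M ↦ TangentSpace (𝓡 m) x)] [MeasurableSpace M] [BorelSpace M] [T2Space M]

/-- On a compact manifold `f` is itself an admissible variation, and its pairing with `df` is
`‖df‖²`. -/
theorem IsHarmonicMap.eq_const_of_compactSpace [CompactSpace M] [PreconnectedSpace M]
    {f : M → EuclideanSpace ℝ (Fin n)} (hf : IsHarmonicMap m f) (x y : M) : f x = f y := by
  refine ext_inner_left ℝ fun ν ↦ ?_
  have h0 := hf.innerDifferential_eq_zero hf.1 (HasCompactSupport.of_compactSpace f) fun x ↦
    Finset.sum_nonneg fun i _ ↦ real_inner_self_nonneg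
  have hd : ∀ x v, inner ℝ ν (differential m f x v) = 0 := fun x ↦
    inner_differential_eq_zero_of_basis fun i ↦ by
      have h := (Finset.sum_eq_zero_iff_of_nonneg fun i _ ↦ real_inner_self_nonneg).1 (h0 x) i
        (Finset.mem_univ i)
      rw [inner_self_eq_zero] at h
      rw [h, inner_zero_right]
  have hlc : IsLocallyConstant fun x ↦ inner ℝ ν (f x) :=
    (IsLocallyConstant.iff_eventually_eq _).2 fun x ↦
      eventually_inner_eq_of_inner_differential_eq_zero hf.1 (Filter.Eventually.of_forall hd)
  exact hlc.apply_eq_of_preconnectedSpace x y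

/-- If a half space cuts out of the region `B` a set whose preimage under the harmonic map `f` is
compact and stays off the boundary of `B`, then the differential of
the height `⟨ν, f⟩` vanishes there. -/
theorem IsHarmonicMap.inner_differential_eq_zero {f : M → EuclideanSpace ℝ (Fin n)}
    (hf : IsHarmonicMap m f) {B : Set (EuclideanSpace ℝ (Fin n))} (hB : IsOpen B)
    {ν : EuclideanSpace ℝ (Fin n)} {c : ℝ}
    (hK : IsCompact {x | f x ∈ closure B ∧ c ≤ inner ℝ ν (f x)})
    (hKB : ∀ x, f x ∈ closure B → c ≤ inner ℝ ν (f x) → f x ∈ B)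
    {x : M} (hx : f x ∈ B) (hxc : c < inner ℝ ν (f x)) (v : TangentSpace (𝓡 m) x) :
    inner ℝ ν (differential m f x v) = 0 := by
  classical
  -- `G` vanishes up to height `c`, and its derivative is a nonnegative multiple of `⟨ν, ·⟩ ν`; this
  -- makes the pairing of `df` with `d(G ∘ f)` a sum of squares with nonnegative weights.
  set G : EuclideanSpace ℝ (Fin n) → EuclideanSpace ℝ (Fin n) :=
    fun y ↦ expNegInvGlue (inner ℝ ν y - c) • ν with hGdef
  have hG : ContDiff ℝ ∞ G :=
    (expNegInvGlue.contDiff.comp ((contDiff_const.inner ℝ contDiff_id).sub contDiff_const)).smul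
      contDiff_const
  have hG' : ∀ y w, fderiv ℝ G y w =
      (deriv expNegInvGlue (inner ℝ ν y - c) * inner ℝ ν w) • ν := fun y w ↦ by
    have hχ : DifferentiableAt ℝ expNegInvGlue (inner ℝ ν y - c) :=
      (expNegInvGlue.contDiff (n := 1)).differentiable (by simp) _
    have := ((hχ.hasDerivAt.comp_hasFDerivAt y
      ((innerSL ℝ ν).hasFDerivAt.sub_const c)).smul_const ν).fderiv
    exact congrArg (fun L : EuclideanSpace ℝ (Fin n) →L[ℝ] EuclideanSpace ℝ (Fin n) ↦ L w) this
  set φ : M → EuclideanSpace ℝ (Fin n) := fun x ↦ if f x ∈ B then G (f x) else 0 with hφdef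
  have hO : IsOpen (f ⁻¹' B) := hB.preimage hf.1.continuous
  have hin : ∀ x, f x ∈ B → φ =ᶠ[nhds x] G ∘ f := fun x hx ↦ by
    filter_upwards [hO.mem_nhds hx] with z hz using if_pos hz
  have hzero : ∀ x, ¬ (f x ∈ closure B ∧ c ≤ inner ℝ ν (f x)) → φ x = 0 := fun x hx ↦ by
    by_cases hxB : f x ∈ B
    · have hlt : inner ℝ ν (f x) < c := not_le.1 fun h ↦ hx ⟨subset_closure hxB, h⟩
      simp [hφdef, hGdef, hxB, hlt.le]
    · exact if_neg hxB
  -- Cutting off at the boundary of `B` stays smooth: by `hKB` a point mapped outside `B` is not in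
  -- the closed set of `hK`, so `φ` vanishes on a whole neighbourhood.
  have hout : ∀ x, f x ∉ B → φ =ᶠ[nhds x] fun _ ↦ 0 := fun x hx ↦ by
    filter_upwards [hK.isClosed.isOpen_compl.mem_nhds fun h ↦ hx (hKB x h.1 h.2)] with z hz
      using hzero z hz
  have hφ : ContMDiff (𝓡 m) (𝓡 n) ∞ φ := fun x ↦ by
    by_cases hxB : f x ∈ B
    · exact (hG.contMDiff.comp hf.1).contMDiffAt.congr_of_eventuallyEq (hin x hxB)
    · exact contMDiffAt_const.congr_of_eventuallyEq (hout x hxB)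
  have hφc : HasCompactSupport φ := HasCompactSupport.intro' hK hK.isClosed hzero
  have hdin : ∀ x, f x ∈ B → innerDifferential m f φ x =
      ∑ i, deriv expNegInvGlue (inner ℝ ν (f x) - c) *
        inner ℝ ν (differential m f x (stdOrthonormalBasis ℝ (TangentSpace (𝓡 m) x) i)) ^ 2 :=
      fun x hxB ↦ by
    refine Finset.sum_congr rfl fun i _ ↦ ?_
    have h : ∀ v, differential m φ x v = fderiv ℝ G (f x) (differential m f x v) := fun v ↦ by
      have h := ((hG.differentiable (by simp) (f x)).hasFDerivAt.hasMFDerivAt.comp x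
        (hf.1.mdifferentiable (by simp) x).hasMFDerivAt).mfderiv
      rw [differential, (hin x hxB).mfderiv_eq, h]
      rfl
    rw [h, hG', inner_smul_right, real_inner_comm ν]
    ring
  have hdout : ∀ x, f x ∉ B → innerDifferential m f φ x = 0 := fun x hxB ↦ by
    have hd : differential m φ x = 0 := by
      rw [differential, (hout x hxB).mfderiv_eq, mfderiv_const]
      rfl
    simp [innerDifferential, hd]
  have hnn : ∀ x, 0 ≤ innerDifferential m f φ x := fun x ↦ by
    by_cases hxB : f x ∈ B
    · rw [hdin x hxB]
      exact Finset.sum_nonneg fun i _ ↦ mul_nonneg (deriv_expNegInvGlue_nonneg _) (sq_nonneg _)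
    · exact (hdout x hxB).ge
  have h0 := hf.innerDifferential_eq_zero hφ hφc hnn x
  rw [hdin x hx] at h0
  refine inner_differential_eq_zero_of_basis (fun i ↦ ?_) v
  have h := (Finset.sum_eq_zero_iff_of_nonneg fun i _ ↦
    mul_nonneg (deriv_expNegInvGlue_nonneg _) (sq_nonneg _)).1 h0 i (Finset.mem_univ i)
  exact pow_eq_zero_iff two_ne_zero |>.1
    ((mul_eq_zero.1 h).resolve_left (deriv_expNegInvGlue_pos (sub_pos.2 hxc)).ne')

end Final

end

end LocalCone

theorem mainTheorem6 {m n : ℕ} {M : Type*} [EMetricSpace M] [ConnectedSpace M]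
    [SecondCountableTopology M] [ChartedSpace (EuclideanSpace ℝ (Fin m)) M]
    [IsManifold (𝓡 m) ∞ M]
    [RiemannianBundle (fun x : M ↦ TangentSpace (𝓡 m) x)]
    [IsContMDiffRiemannianBundle (𝓡 m) ∞ (EuclideanSpace ℝ (Fin m))
      (fun x : M ↦ TangentSpace (𝓡 m) x)]
    [IsRiemannianManifold (𝓡 m) M] [CompleteSpace M] [MeasurableSpace M] [BorelSpace M]
    (C B : Set (EuclideanSpace ℝ (Fin n))) (hCB : LocalCone.IsLocalConeWithRegion C B)
    (f : M → EuclideanSpace ℝ (Fin n)) (hharm : LocalCone.IsHarmonicMap m f)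
    (hproper : ∀ K : Set (EuclideanSpace ℝ (Fin n)), IsCompact K → IsCompact (f ⁻¹' K))
    (hconst : ¬ ∃ c, ∀ x, f x = c) (p : M) (hp : f p ∈ B) :
    ∃ q : M, f q ∈ C ∧ f q ∈ frontier B := by
  obtain ⟨hC, H, hH, ⟨b, -, hBdef⟩, hBc⟩ := hCB
  have hHc : IsClosed H := by
    obtain ⟨ν, -, c, rfl⟩ := hH
    exact isClosed_eq (by fun_prop) continuous_const
  have hF : IsOpen (C ∪ H)ᶜ := (hC.union hHc).isOpen_compl
  have hB : IsOpen B := hBdef ▸ hF.connectedComponentIn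
  have hBF : B ⊆ (C ∪ H)ᶜ := hBdef ▸ connectedComponentIn_subset _ _
  have hfr : frontier B ⊆ C ∪ H := by
    rw [hBdef]
    exact (LocalCone.frontier_connectedComponentIn_subset hF b).trans_eq (compl_compl _)
  obtain ⟨ν, c, hlt, hHν⟩ := hH.exists_lt_inner
    (hBdef ▸ isPreconnected_connectedComponentIn : IsPreconnected B)
    (Set.disjoint_left.2 fun y hy hyH ↦ hBF hy (Or.inr hyH))
  by_contra! hno
  have hcl : ∀ x, f x ∈ closure B → c < inner ℝ ν (f x) → f x ∈ B := fun x hx hxc ↦ by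
    by_contra hxB
    have hxfr : f x ∈ frontier B := by
      rw [hB.frontier_eq]
      exact ⟨hx, hxB⟩
    rcases hfr hxfr with h | h
    · exact hno x h hxfr
    · exact hxc.ne' (hHν _ h)
  have hfc : Continuous f := hharm.1.continuous
  have hνc : Continuous fun x ↦ inner ℝ ν (f x) := by fun_prop
  have hK : IsCompact (f ⁻¹' closure B) := hproper _ hBc
  -- The level must be strictly above `c`: at height `c` itself, `f` may meet the boundary of `B` on
  -- `H`.
  obtain ⟨c', hcc', hc'p⟩ := exists_between (hlt _ hp)
  have hd : ∀ x, f x ∈ B → c' < inner ℝ ν (f x) →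
      ∀ v, inner ℝ ν (LocalCone.differential m f x v) = 0 := fun x hx hxc v ↦
    hharm.inner_differential_eq_zero hB (hK.inter_right (isClosed_le continuous_const hνc))
      (fun z hz hzc ↦ hcl z hz (hcc'.trans_le hzc)) hx hxc v
  -- Taking the closure of `B` makes the set closed. It is also open: its points have height above
  -- `c`, so they are mapped into `B`, where the height is locally constant.
  have hS : {x | f x ∈ closure B ∧ inner ℝ ν (f x) = inner ℝ ν (f p)} = Set.univ := by
    refine IsClopen.eq_univ ⟨(isClosed_closure.preimage hfc).inter
      (isClosed_eq hνc continuous_const), isOpen_iff_mem_nhds.2 fun x ⟨hx, hxp⟩ ↦ ?_⟩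
      ⟨p, subset_closure hp, rfl⟩
    have hxc : c' < inner ℝ ν (f x) := hxp ▸ hc'p
    have hev : ∀ᶠ z in nhds x, f z ∈ B ∧ c' < inner ℝ ν (f z) :=
      (hfc.continuousAt.eventually (hB.mem_nhds (hcl x hx (hcc'.trans hxc)))).and
        (hνc.continuousAt.eventually (lt_mem_nhds hxc))
    filter_upwards [hev, LocalCone.eventually_inner_eq_of_inner_differential_eq_zero hharm.1
      (hev.mono fun z hz ↦ hd z hz.1 hz.2)] with z hz hzx
    exact ⟨subset_closure hz.1, hzx.trans hxp⟩
  have : CompactSpace M := ⟨by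
    convert hK
    exact (Set.eq_univ_of_forall fun x ↦ (hS.ge (Set.mem_univ x)).1).symm⟩
  exact hconst ⟨f p, fun x ↦ hharm.eq_const_of_compactSpace x p⟩
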